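/- (In ZFC.) There exist two countably compact Hausdorff topological groups $\mathbb G_0$ and $\mathbb G_1$ whose product $\mathbb G_0\times\mathbb G_1$, with the product topology, is not countably compact. Here a Hausdorff space is called countably compact if each of its infinite subsets has an accumulation point in the space (equivalently, if each of its countable open covers has a finite subcover). -/

import Mathlib

/-!
The groups are spanned by formal generators and carry the topology of pointwise convergence on a set
of functionals. Besides countably many free generators there is, for each colour and each sequence
of combinations of earlier generators, a further generator of this colour. If the sequence is
linearly independent, the functionals are required to make the new generator its limit along an
ultrafilter reserved for that generator. Over a finite field every infinite set contains a linearly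
independent sequence, so the group spanned by the generators of one colour is countably compact.
Groups of different colours meet in the span of the free generators only. The functionals take
arbitrary values on the free generators, which therefore form a sequence without cluster point in
their span. This span, as the intersection of two of the groups, is homeomorphic to a closed subset
of their product, namely the diagonal; hence the product is not countably compact.

The intersection is as small as claimed only if the functionals separate points. This is ensured by
choosing the ultrafilters along the members of an almost disjoint family of size continuum, and such
that they contain every set missing only `O(n!)` elements of the blocks `[n!, (n + 1)!)`. Let `d` be
a nonzero combination. Countably many generators are relevant for it; after removing finite sets,
their members of the almost disjoint family become disjoint, so the sequences of differences between
limit and approximants can be merged blockwise into a single sequence. Select greedily from it a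
sequence linearly independent modulo `d`. A dimension count shows that at most `n! + 1` indices of
the `n`-th block are lost, and some functional vanishes on the selected differences but not at `d`.
-/

open Cardinal Filter Function Set Topology

universe u v

section AlmostDisjoint

theorem exists_almostDisjoint_family : ∃ A : (ℕ → Bool) → Set ℕ,
    (∀ r, (A r).Infinite) ∧ Pairwise fun r s => (A r ∩ A s).Finite := by
  let code (r : ℕ → Bool) (n : ℕ) : ℕ := Encodable.encode ((List.range n).map r)
  have prefix_eq {r s m n} (h : code r m = code s n) :
      (List.range m).map r = (List.range n).map s := Encodable.encode_injective h
  have length_eq {r s m n} (h : code r m = code s n) : m = n := by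
    simpa using congrArg List.length (prefix_eq h)
  refine ⟨fun r => range (code r), fun r => infinite_range_of_injective fun _ _ => length_eq, ?_⟩
  intro r s hrs
  obtain ⟨i, hi⟩ := Function.ne_iff.1 hrs
  refine ((finite_Iic i).image (code r)).subset ?_
  rintro _ ⟨⟨m, rfl⟩, n, hn⟩
  obtain rfl := length_eq hn
  refine mem_image_of_mem _ (mem_Iic.2 (not_lt.1 fun him => hi ?_))
  exact (List.map_inj_left.1 (prefix_eq hn) i (List.mem_range.2 him)).symm

theorem exists_almostDisjoint_family_of_mk_le_continuum {X : Type u} (hX : #X ≤ 𝔠) :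
    ∃ A : X → Set ℕ, (∀ x, (A x).Infinite) ∧ Pairwise fun x y => (A x ∩ A y).Finite := by
  obtain ⟨r⟩ : Nonempty (X ↪ (ℕ → Bool)) := lift_mk_le'.1 (by simpa using hX)
  obtain ⟨A, hinf, hdisj⟩ := exists_almostDisjoint_family
  exact ⟨A ∘ r, fun x => hinf (r x), hdisj.comp_of_injective r.injective⟩

theorem exists_pairwise_disjoint_finite_diff {X α : Type*} [Countable X] {A : X → Set α}
    (hA : Pairwise fun x y => (A x ∩ A y).Finite) :
    ∃ B : X → Set α, Pairwise (Disjoint on B) ∧ ∀ x, (A x \ B x).Finite := by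
  obtain ⟨e, he⟩ := exists_injective_nat X
  let : LinearOrder X := .lift' e he
  have finite_Iio (x : X) : (Iio x).Finite := (Set.finite_Iio (e x)).preimage he.injOn
  refine ⟨fun x => A x \ ⋃ y ∈ Iio x, A y, ?_, fun x => ?_⟩
  · refine (pairwise_disjoint_on _).2 fun x y hxy => ?_
    exact disjoint_sdiff_right.mono_left (sdiff_subset.trans (subset_biUnion_of_mem hxy))
  · rw [Set.sdiff_sdiff_right_self, inter_iUnion₂]
    exact (finite_Iio x).biUnion fun y hy => hA hy.ne'

theorem exists_forall_eqOn_of_pairwise_disjoint {X α β : Type*} [Nonempty β] {C : X → Set α}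
    (hC : Pairwise (Disjoint on C)) (g : X → α → β) : ∃ v : α → β, ∀ x, EqOn v (g x) (C x) := by
  have (a : α) : ∃ b, ∀ x, a ∈ C x → b = g x a := by
    by_cases h : ∃ x, a ∈ C x
    · obtain ⟨x, hx⟩ := h
      refine ⟨g x a, fun y hy => ?_⟩
      rw [hC.eq (not_disjoint_iff.2 ⟨a, hx, hy⟩)]
    · exact ⟨Classical.arbitrary β, fun x hx => absurd ⟨x, hx⟩ h⟩
  choose v hv using this
  exact ⟨v, fun x a => hv a x⟩

end AlmostDisjoint

section LinearIndependence

theorem linearIndependent_sub_of_notMem_span {α R V : Type*} [DivisionRing R] [AddCommGroup V]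
    [Module R V] {v : α → V} (hv : LinearIndependent R v) {d : V}
    (hd : d ∉ Submodule.span R (range v)) : LinearIndependent R fun a => v a - d := by
  have hdisj : Disjoint (Submodule.span R (range v)) (LinearMap.ker (Submodule.mkQ (R ∙ d))) := by
    rw [Submodule.ker_mkQ]
    exact Submodule.disjoint_span_singleton_of_notMem hd
  have hmod : Submodule.mkQ (R ∙ d) ∘ (fun a => v a - d) = Submodule.mkQ (R ∙ d) ∘ v := by
    ext a
    simp
  exact .of_comp _ (hmod ▸ hv.map hdisj)

theorem exists_seq_linearIndependent_of_infinite {K V : Type*} [DivisionRing K] [Finite K]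
    [AddCommGroup V] [Module K V] {B : Set V} (hB : B.Infinite) :
    ∃ f : ℕ → V, (∀ n, f n ∈ B) ∧ LinearIndependent K f := by
  obtain ⟨b, hbB, hspan, hb⟩ := exists_linearIndependent K B
  have hbinf : b.Infinite := by
    intro hfin
    have : Module.Finite K (Submodule.span K b) := .span_of_finite K hfin
    have : Finite (Submodule.span K b) := Module.finite_of_finite K
    exact hB ((toFinite (Submodule.span K b : Set V)).subset (hspan ▸ Submodule.subset_span))
  let e : ℕ ↪ b := hbinf.natEmbedding
  exact ⟨fun n => e n, fun n => hbB (e n).2, hb.comp e e.injective⟩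

end LinearIndependence

section FreshIndices

variable {ι K V : Type*} [DivisionRing K] [AddCommGroup V] [Module K V]

/-- The indices selected by the greedy algorithm extending `W` along `v`: those `i` at which
`v i` does not lie in the span of `W` and the earlier terms. -/
def freshIndices [Preorder ι] (W : Submodule K V) (v : ι → V) : Set ι :=
  {i | v i ∉ W ⊔ Submodule.span K (v '' Iio i)}

theorem disjoint_span_image_freshIndices [LinearOrder ι] (W : Submodule K V) (v : ι → V) :
    Disjoint W (Submodule.span K (v '' freshIndices W v)) := by
  classical
  refine Submodule.disjoint_def.2 fun x hxW hx => ?_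
  obtain ⟨f, hf, rfl⟩ := (Finsupp.mem_span_image_iff_linearCombination K).1 hx
  rcases f.support.eq_empty_or_nonempty with h | h
  · simp [Finsupp.support_eq_empty.1 h]
  set i := f.support.max' h
  have hmem : i ∈ f.support := Finset.max'_mem _ _
  refine absurd ?_ (hf hmem)
  have hlast : f i • v i = Finsupp.linearCombination K v f -
      Finsupp.linearCombination K v (f.erase i) := by
    rw [eq_sub_iff_add_eq, ← Finsupp.linearCombination_single, ← map_add,
      Finsupp.single_add_erase]
  have hearlier : Finsupp.linearCombination K v (f.erase i) ∈ Submodule.span K (v '' Iio i) := by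
    refine (Finsupp.mem_span_image_iff_linearCombination K).2 ⟨_, fun j hj => ?_, rfl⟩
    rw [Finsupp.support_erase, Finset.coe_erase] at hj
    exact lt_of_le_of_ne (Finset.le_max' _ _ hj.1) hj.2
  rw [← Submodule.smul_mem_iff _ (Finsupp.mem_support_iff.1 hmem), hlast]
  exact sub_mem (Submodule.mem_sup_left hxW) (Submodule.mem_sup_right hearlier)

theorem span_image_Iio_le_sup_span_freshIndices [LinearOrder ι] [WellFoundedLT ι]
    (W : Submodule K V) (v : ι → V) (k : ι) :
    Submodule.span K (v '' Iio k) ≤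
      W ⊔ Submodule.span K (v '' (freshIndices W v ∩ Iio k)) := by
  rw [Submodule.span_le]
  rintro _ ⟨i, hi, rfl⟩
  induction i using WellFoundedLT.induction with
  | ind i ih =>
    by_cases hfresh : i ∈ freshIndices W v
    · exact Submodule.mem_sup_right (Submodule.subset_span ⟨i, ⟨hfresh, hi⟩, rfl⟩)
    · have hstale : v i ∈ W ⊔ Submodule.span K (v '' Iio i) := not_not.1 hfresh
      refine sup_le (α := Submodule K V) le_sup_left (Submodule.span_le.2 ?_) hstale
      rintro _ ⟨j, hj, rfl⟩
      exact ih j hj (lt_trans hj hi)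

theorem finrank_span_image_le_ncard {v : ι → V} {s : Set ι} (hs : s.Finite) :
    Module.finrank K (Submodule.span K (v '' s)) ≤ s.ncard := by
  have := (hs.image v).fintype
  refine (finrank_span_le_card (v '' s)).trans ?_
  rw [← ncard_eq_toFinset_card']
  exact ncard_image_le hs

theorem finrank_span_image_eq_ncard {v : ι → V} {s : Set ι} (hv : LinearIndepOn K v s) :
    Module.finrank K (Submodule.span K (v '' s)) = s.ncard := by
  simpa [Module.finrank, ncard] using congrArg ENat.toNat (toENat_rank_span_set hv)

theorem ncard_Ico_diff_freshIndices_le (W : Submodule K V) [FiniteDimensional K W] {v : ℕ → V}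
    {m n : ℕ} (hv : LinearIndepOn K v (Ico m n)) :
    (Ico m n \ freshIndices W v).ncard ≤ Module.finrank K W + m := by
  set U := freshIndices W v
  have hfin : (U ∩ Iio n).Finite := (finite_Iio n).inter_of_right U
  have : FiniteDimensional K (Submodule.span K (v '' (U ∩ Iio n))) :=
    .span_of_finite K (hfin.image v)
  have hdim : (Ico m n).ncard ≤ Module.finrank K W + (U ∩ Iio n).ncard := calc
    (Ico m n).ncard = Module.finrank K (Submodule.span K (v '' Ico m n)) :=
      (finrank_span_image_eq_ncard hv).symm
    _ ≤ Module.finrank K ↥(W ⊔ Submodule.span K (v '' (U ∩ Iio n))) :=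
      Submodule.finrank_mono <| (Submodule.span_mono (image_mono Ico_subset_Iio_self)).trans
        (span_image_Iio_le_sup_span_freshIndices W v n)
    _ ≤ Module.finrank K W + Module.finrank K (Submodule.span K (v '' (U ∩ Iio n))) :=
      Submodule.finrank_add_le_finrank_add_finrank _ _
    _ ≤ _ := by gcongr; exact finrank_span_image_le_ncard hfin
  have hbefore : (U ∩ Iio n).ncard ≤ m + (Ico m n ∩ U).ncard := calc
    (U ∩ Iio n).ncard ≤ (Iio m ∪ Ico m n ∩ U).ncard :=
      ncard_le_ncard (fun j hj => (lt_or_ge j m).imp id fun h => ⟨⟨h, hj.2⟩, hj.1⟩)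
    _ ≤ (Iio m).ncard + (Ico m n ∩ U).ncard := ncard_union_le _ _
    _ = m + (Ico m n ∩ U).ncard := by simp [ncard_eq_toFinset_card']
  have := ncard_inter_add_ncard_sdiff_eq_ncard (Ico m n) U
  lia

end FreshIndices

section BlockFilter

open scoped Nat

/-- The `n`-th of the consecutive blocks `[n!, (n + 1)!)` of natural numbers. Their lengths `n * n!`
outgrow every constant multiple of the number `n!` of preceding integers. -/
def factorialBlock (n : ℕ) : Set ℕ :=
  Ico n ! (n + 1)!

theorem ncard_factorialBlock (n : ℕ) : (factorialBlock n).ncard = n * n ! := by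
  simp [factorialBlock, ncard_eq_toFinset_card', Nat.factorial_succ, add_mul]

theorem finite_factorialBlock (n : ℕ) : (factorialBlock n).Finite :=
  finite_Ico _ _

theorem pairwise_disjoint_factorialBlock : Pairwise (Disjoint on factorialBlock) :=
  Nat.monotone_factorial.pairwise_disjoint_on_Ico_succ

/-- The filter of the sets that, for some constant `k`, miss at most `k * n!` elements of the `n`-th
factorial block for `l`-almost all `n`. -/
def blockFilter (l : Filter ℕ) : Filter ℕ where
  sets := {S | ∃ k, ∀ᶠ n in l, (factorialBlock n \ S).ncard ≤ k * n !}
  univ_sets := ⟨0, by simp⟩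
  sets_of_superset := by
    rintro S T ⟨k, hk⟩ hST
    refine ⟨k, hk.mono fun n hn => le_trans ?_ hn⟩
    exact ncard_le_ncard (sdiff_subset_sdiff_right hST) (finite_factorialBlock n).sdiff
  inter_sets := by
    rintro S T ⟨k, hk⟩ ⟨k', hk'⟩
    refine ⟨k + k', (hk.and hk').mono fun n hn => ?_⟩
    rw [sdiff_inter, add_mul]
    exact (ncard_union_le _ _).trans (add_le_add hn.1 hn.2)

theorem mem_blockFilter {l : Filter ℕ} {S : Set ℕ} :
    S ∈ blockFilter l ↔ ∃ k, ∀ᶠ n in l, (factorialBlock n \ S).ncard ≤ k * n ! :=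
  Iff.rfl

theorem blockFilter_neBot {l : Filter ℕ} [l.NeBot] (hl : l ≤ atTop) : (blockFilter l).NeBot := by
  refine neBot_iff.2 fun hbot => ?_
  obtain ⟨k, hk⟩ := mem_blockFilter.1 (empty_mem_iff_bot.2 hbot)
  obtain ⟨n, hn, hkn⟩ := (hk.and (hl (eventually_gt_atTop k))).exists
  rw [sdiff_empty, ncard_factorialBlock] at hn
  exact hkn.not_ge (Nat.le_of_mul_le_mul_right hn n.factorial_pos)

theorem blockFilter_le_atTop {l : Filter ℕ} (hl : l ≤ atTop) : blockFilter l ≤ atTop := by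
  refine atTop_basis.ge_iff.2 fun N _ => mem_blockFilter.2 ⟨0, ?_⟩
  filter_upwards [hl (eventually_ge_atTop N)] with n hn
  have : factorialBlock n ⊆ Ici N := fun j hj => hn.trans (n.self_le_factorial.trans hj.1)
  simp [sdiff_eq_empty.2 this]

variable {K V X : Type*} [Field K] [AddCommGroup V] [Module K V]

theorem exists_dual_eventually_blockFilter_eq_zero {l : X → Filter ℕ} {B : X → Set ℕ}
    (hBl : ∀ x, B x ∈ l x) (hB : Pairwise (Disjoint on B)) {g : X → ℕ → V}
    (hg : ∀ x, LinearIndependent K (g x)) {d : V} (hd : d ≠ 0) :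
    ∃ Φ : Module.Dual K V, Φ d ≠ 0 ∧ ∀ x, ∀ᶠ n in blockFilter (l x), Φ (g x n) = 0 := by
  have hdisj : Pairwise (Disjoint on fun x => ⋃ n ∈ B x, factorialBlock n) := by
    intro x y hxy
    simp only [onFun, disjoint_iUnion₂_left, disjoint_iUnion₂_right]
    exact fun n hn m hm => pairwise_disjoint_factorialBlock ((hB hxy).ne_of_mem hm hn)
  obtain ⟨v, hv⟩ := exists_forall_eqOn_of_pairwise_disjoint hdisj g
  set W := Submodule.span K {d}
  have hdU : d ∉ Submodule.span K (v '' freshIndices W v) := fun h =>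
    hd (Submodule.disjoint_def.1 (disjoint_span_image_freshIndices W v) d
      (Submodule.mem_span_singleton_self d) h)
  obtain ⟨Φ, hΦd, hΦ⟩ := Submodule.exists_le_ker_of_notMem hdU
  refine ⟨Φ, hΦd, fun x => mem_blockFilter.2 ⟨2, ?_⟩⟩
  filter_upwards [hBl x] with n hn
  have hvg : EqOn v (g x) (factorialBlock n) := (hv x).mono (subset_biUnion_of_mem hn)
  have hindep : LinearIndepOn K v (factorialBlock n) :=
    ((hg x).linearIndepOn _).congr hvg.symm
  have hsub : factorialBlock n \ {j | Φ (g x j) = 0} ⊆ factorialBlock n \ freshIndices W v :=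
    fun j ⟨hj, hΦj⟩ => ⟨hj, fun hfresh => hΦj <| by
      simpa [hvg hj] using hΦ (Submodule.subset_span (mem_image_of_mem v hfresh))⟩
  calc (factorialBlock n \ {j | Φ (g x j) = 0}).ncard
      ≤ (factorialBlock n \ freshIndices W v).ncard :=
        ncard_le_ncard hsub (finite_factorialBlock n).sdiff
    _ ≤ Module.finrank K W + n ! := ncard_Ico_diff_freshIndices_le W hindep
    _ ≤ n ! + n ! := by
      gcongr
      exact (finrank_span_singleton hd).le.trans n.factorial_pos
    _ = 2 * n ! := (two_mul _).symm

end BlockFilter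

section SeparatesPoints

/-- A family of ultrafilters on `ℕ` is separating for `V` if, whenever linearly independent
sequences are attached to countably many of its indices, each nonzero vector is detected by a
functional vanishing on each of these sequences along the corresponding ultrafilter. -/
def IsSeparatingFamily (K V : Type*) [Field K] [AddCommGroup V] [Module K V] {X : Type*}
    (p : X → Ultrafilter ℕ) : Prop :=
  ∀ ⦃D : Set X⦄, D.Countable → ∀ ⦃g : X → ℕ → V⦄, (∀ x ∈ D, LinearIndependent K (g x)) →
    ∀ ⦃d : V⦄, d ≠ 0 →
      ∃ Φ : Module.Dual K V, Φ d ≠ 0 ∧ ∀ x ∈ D, ∀ᶠ n in p x, Φ (g x n) = 0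

theorem exists_isSeparatingFamily (K V : Type*) [Field K] [AddCommGroup V] [Module K V]
    {X : Type u} (hX : #X ≤ 𝔠) :
    ∃ p : X → Ultrafilter ℕ, (∀ x, p x ≤ (atTop : Filter ℕ)) ∧ IsSeparatingFamily K V p := by
  obtain ⟨A, hinf, hA⟩ := exists_almostDisjoint_family_of_mk_le_continuum hX
  let l (x : X) : Filter ℕ := cofinite ⊓ 𝓟 (A x)
  have hl (x : X) : l x ≤ atTop := inf_le_left.trans Nat.cofinite_eq_atTop.le
  have (x : X) : (l x).NeBot := (hinf x).cofinite_inf_principal_neBot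
  have (x : X) : (blockFilter (l x)).NeBot := blockFilter_neBot (hl x)
  refine ⟨fun x => .of (blockFilter (l x)),
    fun x => (Ultrafilter.of_le _).trans (blockFilter_le_atTop (hl x)), fun D hD g hg d hd => ?_⟩
  have := hD.to_subtype
  obtain ⟨B, hB, hAB⟩ := exists_pairwise_disjoint_finite_diff (A := fun x : D => A x)
    (hA.comp_of_injective Subtype.val_injective)
  have hBl (x : D) : B x ∈ l x := by
    refine mem_inf_principal.2 ((hAB x).subset ?_)
    simp [subset_def]
  obtain ⟨Φ, hΦd, hΦ⟩ := exists_dual_eventually_blockFilter_eq_zero hBl hB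
    (g := fun x : D => g x) (fun x => hg x x.2) hd
  exact ⟨Φ, hΦd, fun x hx => Ultrafilter.of_le _ (hΦ ⟨x, hx⟩)⟩

end SeparatesPoints

section Limits

theorem accPt_principal_of_mapClusterPt {α E : Type*} [TopologicalSpace E] {x : α → E} {B : Set E}
    {a : E} (hx : Injective x) (hxB : ∀ i, x i ∈ B) (ha : MapClusterPt a cofinite x) :
    AccPt a (𝓟 B) := by
  refine accPt_iff_clusterPt.2 (ClusterPt.mono ha (le_inf ?_ ?_))
  · exact tendsto_principal.2 ((finite_singleton a).preimage hx.injOn).compl_mem_cofinite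
  · exact tendsto_principal.2 (.of_forall hxB)

theorem isCountablyCompact_image_of_linearIndependent {K V E : Type*} [DivisionRing K] [Finite K]
    [AddCommGroup V] [Module K V] [TopologicalSpace E] [T1Space E] {f : V → E} {S : Set V}
    (h : ∀ u : ℕ → V, (∀ n, u n ∈ S) → LinearIndependent K u →
      ∃ a ∈ S, MapClusterPt (f a) atTop (fun n => f (u n))) : IsCountablyCompact (f '' S) := by
  refine isCountablyCompact_iff_infinite_subset_has_accPt.2 fun B hB hBinf => ?_
  obtain ⟨T, hTS, hT⟩ := SurjOn.exists_bijOn_subset hB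
  have hTinf : T.Infinite := .of_image f (hT.image_eq.symm ▸ hBinf)
  obtain ⟨u, huT, hu⟩ := exists_seq_linearIndependent_of_infinite (K := K) hTinf
  obtain ⟨a, haS, ha⟩ := h u (fun n => hTS (huT n)) hu
  refine ⟨f a, mem_image_of_mem f haS, accPt_principal_of_mapClusterPt (x := fun n => f (u n)) ?_
    (fun n => hT.mapsTo (huT n)) (Nat.cofinite_eq_atTop ▸ ha)⟩
  exact fun m n hmn => hu.injective (hT.injOn (huT m) (huT n) hmn)

theorem isCountablyCompact_inter_of_prod {E : Type*} [TopologicalSpace E] [T2Space E] {A B : Set E}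
    [CountablyCompactSpace (A × B)] : IsCountablyCompact (A ∩ B) := by
  have hdiag : IsClosed {q : A × B | (q.1 : E) = q.2} := isClosed_eq (by fun_prop) (by fun_prop)
  have himage : (fun q : A × B => (q.1 : E)) '' {q | (q.1 : E) = q.2} = A ∩ B := by
    ext a
    constructor
    · rintro ⟨⟨a, b⟩, hab, rfl⟩
      exact ⟨a.2, mem_of_eq_of_mem hab b.2⟩
    · rintro ⟨ha, hb⟩
      exact ⟨(⟨a, ha⟩, ⟨a, hb⟩), rfl, rfl⟩
  exact himage ▸ hdiag.isCountablyCompact.image (by fun_prop)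

theorem exists_eventually_eq_of_finite {α β : Type*} [Finite β] (p : Ultrafilter α) (f : α → β) :
    ∃ b, ∀ᶠ a in p, f a = b := by
  obtain ⟨b, hb⟩ := (p.map f).eq_pure_of_finite
  have hmem : {b} ∈ p.map f := hb ▸ mem_pure.2 rfl
  exact ⟨b, hmem⟩

end Limits

/-- Generators of the groups to be constructed: free generators `base n`, and generators
`lim i c s` labelled by `i : ι` and meant as the limit, along an ultrafilter, of the linear
combinations `∑ j, c n j • s j` of earlier generators. -/
inductive Generator (ι : Type u) (K : Type v) [Zero K] : Type (max u v)
  | base (n : ℕ)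
  | lim (i : ι) (c : ℕ → ℕ →₀ K) (s : ℕ → Generator ι K)

namespace Generator

section Cardinality

variable {ι : Type u} {K : Type v} [Zero K]

/-- The arities of the W-type whose elements encode generators. -/
def Arity : ℕ ⊕ ι × (ℕ → ℕ →₀ K) → Type
  | .inl _ => Empty
  | .inr _ => ℕ

/-- The encoding of generators as elements of a W-type, used to count them. -/
def toWType : Generator ι K → WType (Arity (ι := ι) (K := K))
  | base n => ⟨.inl n, Empty.elim⟩
  | lim i c s => ⟨.inr (i, c), fun j : ℕ => (s j).toWType⟩

theorem toWType_injective : Injective (toWType : Generator ι K → _) := by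
  intro x
  induction x with
  | base n =>
    rintro (m | ⟨i, c, s⟩) h
    · cases h
      rfl
    · cases h
  | lim i c s ih =>
    rintro (m | ⟨i', c', s'⟩) h
    · cases h
    · injection h with hlabel hchildren
      cases hlabel
      rw [funext fun j => ih j (congrFun hchildren j)]

theorem mk_le_continuum [Countable K] (hι : #ι ≤ 𝔠) : #(Generator ι K) ≤ 𝔠 := by
  have hcoeff : #(ℕ → ℕ →₀ K) ≤ 𝔠 := by
    simpa using power_le_power_right (c := ℵ₀) (mk_le_aleph0 (α := ℕ →₀ K))
  have hlim : #(ι × (ℕ → ℕ →₀ K)) ≤ 𝔠 := by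
    rw [mk_prod, ← continuum_mul_self]
    exact mul_le_mul' (lift_le_continuum.2 hι) (lift_le_continuum.2 hcoeff)
  have hpow : ∀ a : ℕ ⊕ ι × (ℕ → ℕ →₀ K), 𝔠 ^ lift #(Arity a) ≤ (𝔠 : Cardinal.{max u v}) := by
    rintro (n | ic)
    · simpa [Arity] using (nat_lt_continuum 1).le
    · simp [Arity]
  refine (mk_le_of_injective toWType_injective).trans (WType.cardinalMk_le_of_le' ?_)
  refine (sum_le_sum _ _ hpow).trans ?_
  rw [sum_const', mk_sum]
  refine mul_le_of_le aleph0_le_continuum (add_le_of_le aleph0_le_continuum ?_ ?_) le_rfl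
  · simpa using aleph0_le_continuum
  · simpa using hlim

end Cardinality

section Hereditary

variable {ι : Type u} {K : Type v} [Zero K]

theorem child_ne_lim (i : ι) (c : ℕ → ℕ →₀ K) (s : ℕ → Generator ι K) (j : ℕ) :
    s j ≠ lim i c s := by
  suffices ∀ x i c (s : ℕ → Generator ι K), x = lim i c s → ∀ j, s j ≠ x from this _ i c s rfl j
  intro x
  induction x with
  | base n => rintro _ _ _ ⟨⟩
  | lim i c s ih =>
    rintro _ _ _ ⟨⟩ j hj
    exact ih j i c s hj j rfl

/-- A set of generators is hereditary if it contains, with each limit generator, the generators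
whose combinations this generator is the limit of. -/
def IsHereditary (D : Set (Generator ι K)) : Prop :=
  ∀ ⦃i c s⦄, lim i c s ∈ D → ∀ j, s j ∈ D

theorem isHereditary_range_base : IsHereditary (range (base : ℕ → Generator ι K)) := by
  rintro i c s ⟨n, ⟨⟩⟩

theorem IsHereditary.iUnion {α : Sort*} {D : α → Set (Generator ι K)}
    (hD : ∀ a, IsHereditary (D a)) : IsHereditary (⋃ a, D a) := by
  intro i c s h j
  obtain ⟨a, ha⟩ := mem_iUnion.1 h
  exact mem_iUnion.2 ⟨a, hD a ha j⟩

theorem exists_countable_isHereditary_mem (x : Generator ι K) :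
    ∃ D : Set (Generator ι K), D.Countable ∧ IsHereditary D ∧ x ∈ D := by
  induction x with
  | base n => exact ⟨range base, countable_range _, isHereditary_range_base, mem_range_self n⟩
  | lim i c s ih =>
    choose D hD hher hmem using ih
    refine ⟨insert (lim i c s) (⋃ j, D j), (countable_iUnion hD).insert _, ?_, mem_insert _ _⟩
    rintro i' c' s' (h | h) j
    · cases h
      exact Or.inr (mem_iUnion.2 ⟨j, hmem j⟩)
    · exact Or.inr (IsHereditary.iUnion hher h j)

theorem exists_countable_isHereditary_superset {F : Set (Generator ι K)} (hF : F.Countable) :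
    ∃ D : Set (Generator ι K), D.Countable ∧ IsHereditary D ∧ F ⊆ D := by
  choose D hD hher hmem using exists_countable_isHereditary_mem (ι := ι) (K := K)
  exact ⟨⋃ x ∈ F, D x, hF.biUnion fun x _ => hD x, .iUnion fun x => .iUnion fun _ => hher x,
    fun x hx => mem_biUnion hx (hmem x)⟩

/-- A generator is monochromatic of colour `i` if all labels in its construction equal `i`. -/
def Monochromatic (i : ι) : Generator ι K → Prop
  | base _ => True
  | lim i' _ s => i' = i ∧ ∀ j, (s j).Monochromatic i

theorem setOf_monochromatic_inter_setOf_monochromatic {i j : ι} (hij : i ≠ j) :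
    {x : Generator ι K | x.Monochromatic i} ∩ {x | x.Monochromatic j} = range base := by
  refine Subset.antisymm ?_ (range_subset_iff.2 fun n => ⟨trivial, trivial⟩)
  rintro (n | ⟨k, c, s⟩) ⟨hi, hj⟩
  · exact mem_range_self n
  · exact absurd (hi.1.symm.trans hj.1) hij

end Hereditary

section Approximants

variable {ι : Type u} {K : Type v}

/-- The combinations `∑ j, c n j • s j` that a generator `lim i c s` is meant to be the limit of. -/
noncomputable def approximant [AddCommMonoid K] (c : ℕ → ℕ →₀ K) (s : ℕ → Generator ι K) (n : ℕ) :
    Generator ι K →₀ K :=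
  (c n).mapDomain s

theorem exists_approximant_eq [Semiring K] {S : Set (Generator ι K)} (hS : base 0 ∈ S)
    {f : ℕ → Generator ι K →₀ K} (hf : ∀ n, f n ∈ Finsupp.supported K K S) :
    ∃ c s, approximant c s = f ∧ ∀ j, s j ∈ S := by
  let T : Set (Generator ι K) := insert (base 0) (⋃ n, (f n).support)
  have hTcount : T.Countable := (countable_iUnion fun n => (f n).support.countable_toSet).insert _
  have hTS : T ⊆ S := insert_subset hS (iUnion_subset hf)
  obtain ⟨s, hs⟩ := hTcount.exists_eq_range (insert_nonempty _ _)
  have hfT (n : ℕ) :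
      f n ∈ (Finsupp.supported K K (univ : Set ℕ)).map (Finsupp.lmapDomain K K s) := by
    rw [Finsupp.lmapDomain_supported, image_univ, ← hs]
    exact (subset_iUnion (fun n => ((f n).support : Set (Generator ι K))) n).trans
      (subset_insert _ _)
  choose c _ hc using hfT
  exact ⟨c, s, funext hc, fun j => hTS (hs ▸ mem_range_self j)⟩

theorem approximant_mem_supported [Semiring K] {c : ℕ → ℕ →₀ K} {s : ℕ → Generator ι K}
    {D : Set (Generator ι K)} (hs : ∀ j, s j ∈ D) (n : ℕ) :
    approximant c s n ∈ Finsupp.supported K K D := by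
  classical
  refine (Finset.coe_subset.2 Finsupp.mapDomain_support).trans ?_
  rw [Finset.coe_image]
  exact image_subset_iff.2 fun j _ => hs j

/-- The difference between a combination of generators and the limit generator it is meant to
approximate. Base generators are not limits of anything, and their gaps are zero. -/
noncomputable def gap [Ring K] : Generator ι K → ℕ → Generator ι K →₀ K
  | base _, _ => 0
  | lim i c s, n => approximant c s n - Finsupp.single (lim i c s) 1

theorem gap_mem_supported [Ring K] {D : Set (Generator ι K)} (hD : IsHereditary D)
    {x : Generator ι K} (hx : x ∈ D) (n : ℕ) : gap x n ∈ Finsupp.supported K K D := by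
  cases x with
  | base m => exact zero_mem _
  | lim i c s =>
    exact sub_mem (approximant_mem_supported (hD hx) n) (Finsupp.single_mem_supported K 1 hx)

theorem linearIndependent_gap [DivisionRing K] (i : ι) {c : ℕ → ℕ →₀ K}
    {s : ℕ → Generator ι K} (h : LinearIndependent K (approximant c s)) :
    LinearIndependent K (gap (lim i c s)) := by
  refine linearIndependent_sub_of_notMem_span h fun hmem => ?_
  have hle : Submodule.span K (range (approximant c s)) ≤ Finsupp.supported K K (range s) := by
    rw [Submodule.span_le]
    exact range_subset_iff.2 (approximant_mem_supported mem_range_self)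
  obtain ⟨j, hj⟩ : lim i c s ∈ range s := by
    simpa [Finsupp.mem_supported, Finsupp.support_single] using hle hmem
  exact child_ne_lim i c s j hj

end Approximants

section Functionals

variable {ι : Type u} {K : Type v} [Field K]

/-- A functional on formal combinations of generators respects the limits in `D` if its value at
each limit generator in `D` is the limit, along the ultrafilter attached to this generator, of its
values at the approximants. Nothing is required unless the gaps are linearly independent. -/
def RespectsLimitsOn (p : Generator ι K → Ultrafilter ℕ) (D : Set (Generator ι K))
    (Φ : Module.Dual K (Generator ι K →₀ K)) : Prop :=
  ∀ x ∈ D, LinearIndependent K (gap x) → ∀ᶠ n in p x, Φ (gap x n) = 0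

open scoped Classical in
/-- The recursive extension to all generators of a function `φ` given on `D`: outside `D`, the value
at a limit generator is the ultrafilter limit of the values of the approximants. -/
noncomputable def extend [Finite K] (p : Generator ι K → Ultrafilter ℕ) (D : Set (Generator ι K))
    (φ : Generator ι K → K) : Generator ι K → K
  | base n => φ (base n)
  | lim i c s =>
    if lim i c s ∈ D then φ (lim i c s)
    else (exists_eventually_eq_of_finite (p (lim i c s)) fun n =>
      Finsupp.linearCombination K (fun j => extend p D φ (s j)) (c n)).choose

theorem extend_of_mem [Finite K] (p : Generator ι K → Ultrafilter ℕ) {D : Set (Generator ι K)}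
    (φ : Generator ι K → K) {x : Generator ι K} (hx : x ∈ D) : extend p D φ x = φ x := by
  cases x with
  | base n => rfl
  | lim i c s => rw [extend, if_pos hx]

theorem eventually_extend_of_notMem [Finite K] (p : Generator ι K → Ultrafilter ℕ)
    {D : Set (Generator ι K)} (φ : Generator ι K → K) {i : ι} {c : ℕ → ℕ →₀ K}
    {s : ℕ → Generator ι K} (h : lim i c s ∉ D) :
    ∀ᶠ n in p (lim i c s),
      Finsupp.linearCombination K (extend p D φ) (approximant c s n) =
        extend p D φ (lim i c s) := by
  rw [extend, if_neg h]
  simp only [approximant, Finsupp.linearCombination_mapDomain]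
  exact (exists_eventually_eq_of_finite _ _).choose_spec

theorem exists_respectsLimitsOn_univ_extension [Finite K] {p : Generator ι K → Ultrafilter ℕ}
    {D : Set (Generator ι K)} (hD : IsHereditary D) {Φ : Module.Dual K (Generator ι K →₀ K)}
    (hΦ : RespectsLimitsOn p D Φ) :
    ∃ Ψ, RespectsLimitsOn p univ Ψ ∧ ∀ v ∈ Finsupp.supported K K D, Ψ v = Φ v := by
  let φ (x : Generator ι K) : K := Φ (Finsupp.single x 1)
  have hagree : EqOn (Finsupp.linearCombination K (extend p D φ)) Φ
      (Finsupp.supported K K D) := by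
    rw [Finsupp.supported_eq_span_single]
    refine LinearMap.eqOn_span ?_
    rintro _ ⟨x, hx, rfl⟩
    rw [Finsupp.linearCombination_single, one_smul, extend_of_mem p φ hx]
  refine ⟨Finsupp.linearCombination K (extend p D φ), fun x _ hindep => ?_,
    fun _ hv => hagree hv⟩
  by_cases hx : x ∈ D
  · filter_upwards [hΦ x hx hindep] with n hn
    rw [hagree (gap_mem_supported hD hx n), hn]
  · cases x with
    | base m => exact .of_forall fun _ => map_zero _
    | lim i c s =>
      filter_upwards [eventually_extend_of_notMem p φ hx] with n hn
      rw [gap, map_sub, hn, Finsupp.linearCombination_single, one_smul, sub_self]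

theorem exists_respectsLimitsOn_univ_base [Finite K] (p : Generator ι K → Ultrafilter ℕ)
    (φ : ℕ → K) : ∃ Ψ, RespectsLimitsOn p univ Ψ ∧
      ∀ n, Ψ (Finsupp.single (base n) 1) = φ n := by
  let Φ : Module.Dual K (Generator ι K →₀ K) :=
    Finsupp.linearCombination K fun | base n => φ n | lim _ _ _ => 0
  have hΦ : RespectsLimitsOn p (range base) Φ := by
    rintro _ ⟨n, rfl⟩ -
    exact .of_forall fun _ => map_zero Φ
  obtain ⟨Ψ, hΨ, heq⟩ := exists_respectsLimitsOn_univ_extension isHereditary_range_base hΦ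
  refine ⟨Ψ, hΨ, fun n => ?_⟩
  rw [heq _ (Finsupp.single_mem_supported K 1 (mem_range_self n))]
  simp [Φ]

theorem exists_respectsLimitsOn_univ_ne_zero [Finite K] {p : Generator ι K → Ultrafilter ℕ}
    (hp : IsSeparatingFamily K (Generator ι K →₀ K) p) {d : Generator ι K →₀ K} (hd : d ≠ 0) :
    ∃ Ψ, RespectsLimitsOn p univ Ψ ∧ Ψ d ≠ 0 := by
  obtain ⟨D, hDcount, hDher, hdD⟩ :=
    exists_countable_isHereditary_superset d.support.countable_toSet
  obtain ⟨Φ, hΦd, hΦ⟩ := hp (D := {x ∈ D | LinearIndependent K (gap x)})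
    (hDcount.mono (sep_subset _ _)) (fun x hx => hx.2) hd
  obtain ⟨Ψ, hΨ, heq⟩ :=
    exists_respectsLimitsOn_univ_extension hDher fun x hx hindep => hΦ x ⟨hx, hindep⟩
  exact ⟨Ψ, hΨ, by rwa [heq d hdD]⟩

end Functionals

section Eval

variable {ι : Type u} {K : Type v} [Field K] {p : Generator ι K → Ultrafilter ℕ}

/-- Evaluation of formal combinations of generators at all limit-respecting functionals. It
transports the topology of pointwise convergence to the formal combinations. -/
noncomputable def eval (p : Generator ι K → Ultrafilter ℕ) :
    (Generator ι K →₀ K) →ₗ[K] ({Φ // RespectsLimitsOn p univ Φ} → K) :=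
  LinearMap.pi Subtype.val

theorem eval_injective [Finite K] (hp : IsSeparatingFamily K (Generator ι K →₀ K) p) :
    Injective (eval p) := by
  refine (injective_iff_map_eq_zero _).2 fun d hd => by_contra fun hne => ?_
  obtain ⟨Ψ, hΨ, hΨd⟩ := exists_respectsLimitsOn_univ_ne_zero hp hne
  exact hΨd (congrFun hd ⟨Ψ, hΨ⟩)

theorem tendsto_eval_approximant [TopologicalSpace K] (i : ι) {c : ℕ → ℕ →₀ K}
    {s : ℕ → Generator ι K} (h : LinearIndependent K (approximant c s)) :
    Tendsto (fun n => eval p (approximant c s n)) (p (lim i c s))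
      (𝓝 (eval p (Finsupp.single (lim i c s) 1))) := by
  refine tendsto_pi_nhds.2 fun Ψ => tendsto_nhds_of_eventually_eq ?_
  filter_upwards [Ψ.2 _ (mem_univ _) (linearIndependent_gap i h)] with n hn
  rwa [gap, map_sub, sub_eq_zero] at hn

/-- The image in the space of evaluations of the combinations of generators monochromatic of
colour `i`. -/
noncomputable def monochromaticSubmodule (p : Generator ι K → Ultrafilter ℕ) (i : ι) :
    Submodule K ({Φ // RespectsLimitsOn p univ Φ} → K) :=
  (Finsupp.supported K K {x | x.Monochromatic i}).map (eval p)

theorem monochromaticSubmodule_inf_monochromaticSubmodule (hp : Injective (eval p)) {i j : ι}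
    (hij : i ≠ j) : monochromaticSubmodule p i ⊓ monochromaticSubmodule p j =
      (Finsupp.supported K K (range base)).map (eval p) := by
  rw [monochromaticSubmodule, monochromaticSubmodule, ← Submodule.map_inf _ hp,
    ← Finsupp.supported_inter, setOf_monochromatic_inter_setOf_monochromatic hij]

variable [Finite K] [TopologicalSpace K]

theorem isCountablyCompact_monochromaticSubmodule [T1Space K]
    (hp : ∀ x, p x ≤ (atTop : Filter ℕ)) (i : ι) :
    IsCountablyCompact (SetLike.coe (monochromaticSubmodule p i)) := by
  refine isCountablyCompact_image_of_linearIndependent (K := K) fun f hfS hf => ?_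
  obtain ⟨c, s, rfl, hs⟩ := exists_approximant_eq (S := {x | x.Monochromatic i}) trivial hfS
  have hlim : (lim i c s).Monochromatic i := ⟨rfl, hs⟩
  exact ⟨_, Finsupp.single_mem_supported K 1 hlim,
    (tendsto_eval_approximant i hf).mapClusterPt.mono (map_mono (hp _))⟩

theorem not_isCountablyCompact_map_supported_range_base [DiscreteTopology K] :
    ¬ IsCountablyCompact (SetLike.coe ((Finsupp.supported K K (range base)).map (eval p))) := by
  classical
  intro hcc
  let e (n : ℕ) : Generator ι K →₀ K := Finsupp.single (base n) 1
  have he (n : ℕ) : e n ∈ Finsupp.supported K K (range base) :=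
    Finsupp.single_mem_supported K 1 (mem_range_self n)
  obtain ⟨_, ⟨v, hv, rfl⟩, hcluster⟩ := isCountablyCompact_iff_seq_clusterPt.1 hcc
    (fun n => eval p (e n)) (.of_forall fun n => Submodule.mem_map_of_mem (he n))
  obtain ⟨Ψ, hΨ, hΨbase⟩ := exists_respectsLimitsOn_univ_base p
    fun n => if base n ∈ v.support then 0 else 1
  have hΨv : Ψ v = 0 := by
    rw [← v.sum_single, map_finsuppSum]
    refine Finset.sum_eq_zero fun x hx => ?_
    obtain ⟨n, rfl⟩ := hv hx
    change Ψ (Finsupp.single _ _) = 0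
    rw [← Finsupp.smul_single_one, map_smul, hΨbase, if_pos hx, smul_zero]
  have hΨe : ∀ᶠ n in atTop, Ψ (e n) = 1 := by
    have hfin : {n | base n ∈ v.support}.Finite :=
      v.support.finite_toSet.preimage fun m _ n _ => base.inj
    filter_upwards [Nat.cofinite_eq_atTop ▸ hfin.eventually_cofinite_notMem] with n hn
    exact (hΨbase n).trans (if_neg hn)
  have hfreq : ∃ᶠ n in atTop, Ψ (e n) = Ψ v :=
    (hcluster.tendsto_comp (continuous_apply ⟨Ψ, hΨ⟩).continuousAt).frequently
      ((isOpen_discrete {Ψ v}).mem_nhds rfl)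
  obtain ⟨n, hn, hn'⟩ := (hfreq.and_eventually hΨe).exists
  exact one_ne_zero (hn'.symm.trans (hn.trans hΨv))

end Eval

end Generator

open Generator in
theorem mainTheorem2_general (K : Type v) [Field K] [Finite K] [TopologicalSpace K]
    [DiscreteTopology K] (ι : Type u) (hι : #ι ≤ 𝔠) :
    ∃ (X : Type (max u v)) (G : ι → Submodule K (X → K)), (∀ i, CountablyCompactSpace (G i)) ∧
      Pairwise fun i j => ¬ CountablyCompactSpace (G i × G j) := by
  obtain ⟨p, hp, hsep⟩ :=
    exists_isSeparatingFamily K (Generator ι K →₀ K) (mk_le_continuum (K := K) hι)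
  refine ⟨_, monochromaticSubmodule p, fun i => ?_, fun i j hij hprod => ?_⟩
  · exact isCountablyCompact_iff_countablyCompactSpace.1
      (isCountablyCompact_monochromaticSubmodule hp i)
  · have hinter : IsCountablyCompact (SetLike.coe
        (monochromaticSubmodule p i ⊓ monochromaticSubmodule p j)) :=
      isCountablyCompact_inter_of_prod
    rw [monochromaticSubmodule_inf_monochromaticSubmodule (eval_injective hsep) hij] at hinter
    exact not_isCountablyCompact_map_supported_range_base hinter

theorem mainTheorem2 :
    ∃ (G₀ G₁ : Type)
      (_ : Group G₀) (_ : TopologicalSpace G₀) (_ : IsTopologicalGroup G₀) (_ : T2Space G₀)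
      (_ : Group G₁) (_ : TopologicalSpace G₁) (_ : IsTopologicalGroup G₁) (_ : T2Space G₁),
      CountablyCompactSpace G₀ ∧ CountablyCompactSpace G₁ ∧
        ¬ CountablyCompactSpace (G₀ × G₁) := by
  obtain ⟨X, G, hG, hprod⟩ :=
    mainTheorem2_general (ZMod 2) Bool (mk_le_aleph0.trans aleph0_le_continuum)
  exact ⟨Multiplicative (G false), Multiplicative (G true), inferInstance, inferInstance,
    inferInstance, inferInstanceAs (T2Space (G false)), inferInstance, inferInstance,
    inferInstance, inferInstanceAs (T2Space (G true)), hG false, hG true,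
    hprod Bool.false_ne_true⟩
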